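/- Let $\mathbb D=\{z\in\mathbb C:|z|<1\}$, $\partial_z=\tfrac12(\partial_x-i\partial_y)$ and $\partial_{\bar z}=\tfrac12(\partial_x+i\partial_y)$. Let $\alpha,\beta\in\mathbb R$ be such that neither $\alpha$ nor $\beta$ is an integer and $-1<\alpha+\beta<0$. Let $u:\mathbb D\to\mathbb C$ be $(\alpha,\beta)$-harmonic, that is, $u$ is twice continuously differentiable on $\mathbb D$ (in the real sense) and $$(1-|z|^2)\Big((1-|z|^2)\,\partial_z\partial_{\bar z}u+\alpha z\,\partial_z u+\beta\bar z\,\partial_{\bar z}u-\alpha\beta\,u\Big)=0\quad\text{on }\mathbb D.$$ Let $H^1_G(\mathbb D)$ be the space of all measurable functions $v:\mathbb D\to\mathbb C$ such that the mean $M_1(r,v)=\frac1{2\pi}\int_0^{2\pi}|v(re^{i\theta})|\,d\theta$ exists for every $r\in(0,1)$ and $\sup_{0<r<1}M_1(r,v)<\infty$. If $\partial_z u\in H^1_G(\mathbb D)$ or $\partial_{\bar z}u\in H^1_G(\mathbb D)$, then $u(z)=0$ for every $z\in\mathbb D$. -/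

import Mathlib

open MeasureTheory Metric Set
open scoped ENNReal

noncomputable section

/-- The open unit disc `𝔻 ⊆ ℂ`. A function on `𝔻` is represented by a function `ℂ → ℂ` of which
only the values on `𝔻` matter. -/
def unitDisc : Set ℂ := ball 0 1

/-- The Wirtinger derivative `∂_z u = (∂_x u - i ∂_y u) / 2`. -/
def dz (u : ℂ → ℂ) (z : ℂ) : ℂ :=
  (1 / 2 : ℂ) * (fderiv ℝ u z 1 - Complex.I * fderiv ℝ u z Complex.I)

/-- The Wirtinger derivative `∂_{z̄} u = (∂_x u + i ∂_y u) / 2`. -/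
def dzbar (u : ℂ → ℂ) (z : ℂ) : ℂ :=
  (1 / 2 : ℂ) * (fderiv ℝ u z 1 + Complex.I * fderiv ℝ u z Complex.I)

/-- The operator
`Δ_{α,β} = (1 - |z|²) ((1 - |z|²) ∂_z ∂_{z̄} + α z ∂_z + β z̄ ∂_{z̄} - α β)`. -/
def laplaceAB (α β : ℝ) (u : ℂ → ℂ) (z : ℂ) : ℂ :=
  (1 - (‖z‖ : ℂ) ^ 2) *
    ((1 - (‖z‖ : ℂ) ^ 2) * dz (dzbar u) z + (α : ℂ) * z * dz u z
      + (β : ℂ) * (starRingEnd ℂ) z * dzbar u z - (α : ℂ) * (β : ℂ) * u z)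

/-- `u` is `(α,β)`-harmonic: twice continuously (real) differentiable on the unit disc, with
`Δ_{α,β} u = 0` there. -/
structure IsABHarmonic (α β : ℝ) (u : ℂ → ℂ) : Prop where
  contDiffOn : ContDiffOn ℝ 2 u unitDisc
  laplaceAB_eq_zero : ∀ z ∈ unitDisc, laplaceAB α β u z = 0

/-- The integral mean `M_p(r,u) = ((1/2π) ∫_0^{2π} |u(r e^{iθ})|^p dθ)^{1/p}`, for `0 < p < ∞`,
as an element of `[0,∞]`. -/
def integralMean (p r : ℝ) (u : ℂ → ℂ) : ℝ≥0∞ :=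
  (ENNReal.ofReal (1 / (2 * Real.pi)) *
    ∫⁻ θ in Ioc 0 (2 * Real.pi), ‖u (circleMap 0 r θ)‖ₑ ^ p) ^ (1 / p)

/-- The quantity `‖u‖_p ∈ [0,∞]`: the supremum over `0 < r < 1` of `M_p(r,u)` when
`0 < p < ∞`, and the supremum of `|u|` over the disc when `p = ∞`. -/
def hardyNorm (p : ℝ≥0∞) (u : ℂ → ℂ) : ℝ≥0∞ :=
  if p = ∞ then ⨆ z ∈ unitDisc, ‖u z‖ₑ
  else ⨆ r ∈ Ioo (0 : ℝ) 1, integralMean p.toReal r u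

/-- Membership in the generalized Hardy space `H_G^p(𝔻)`, `0 < p ≤ ∞`: `u` is (Lebesgue)
measurable on the disc, `M_p(r,u)` exists for every `0 < r < 1` (that is, its integrand is
measurable; only relevant for `p < ∞`), and `‖u‖_p < ∞`. -/
structure MemHardyG (p : ℝ≥0∞) (u : ℂ → ℂ) : Prop where
  pos : 0 < p
  aemeasurable : AEMeasurable u (volume.restrict unitDisc)
  mean_exists : p ≠ ∞ → ∀ r ∈ Ioo (0 : ℝ) 1,
    AEMeasurable (fun θ : ℝ => ‖u (circleMap 0 r θ)‖ₑ ^ p.toReal)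
      (volume.restrict (Ioc 0 (2 * Real.pi)))
  hardyNorm_lt_top : hardyNorm p u < ∞

end

noncomputable section

open Filter Topology

/-! ### Power series with polynomially bounded coefficients -/

/-! The Fourier modes of `u` on circles decouple the equation. For the `k`-th mode, let `y` and `q`
be the modes of `u` and `z̄ ∂_z̄ u`. Since `r ∂_r = z ∂_z + z̄ ∂_z̄` and `-i ∂_θ = z ∂_z - z̄ ∂_z̄`,
the pair `(y, q)` solves a linear first order system on `(0,1)`.

For `k ≥ 0` one solution is explicit: `hgRadial` and `hgRadialBar`, power series with hypergeometric
coefficients `a_n`. The Wronskian against it is a constant times `(1 - r²)^(α+β)`. As `u` is C¹ at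
the origin, this Wronskian tends to `0` there, so it vanishes (`wronskian_eq_zero`) and `(y, q)` is
a multiple `c` of the explicit solution.

The Hardy hypothesis bounds the mode of `z ∂_z u` or of `z̄ ∂_z̄ u`, that is, `q + k y` or `q`. For
the explicit solution these have coefficients `(n + b) a_n` with `b ≥ 0`. No `a_n` vanishes because
`α` and `β` are not integers, and `a_n` decays like `n^(-2-α-β)`. As `α + β < 0`, `n a_n` is
eventually of one sign and at least of order `1/n`, so the series is unbounded as `r → 1`
(`hgRadialBar_add_mul_not_bounded`). Hence `c = 0` (`eq_zero_of_mode_system`). Negative `k` reduces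
to this case by exchanging `∂_z` with `∂_z̄` and `α` with `β`. All modes vanish, so `u = 0`. -/

theorem summable_mul_pow_of_polyBound {c : ℕ → ℝ} {C : ℝ} {m : ℕ}
    (hc : ∀ n, |c n| ≤ C * ((n : ℝ) + 1) ^ m) (k : ℕ) {r : ℝ} (h0 : 0 ≤ r) (h1 : r < 1) :
    Summable fun n => c n * r ^ (2 * n + k) := by
  rcases h0.eq_or_lt with rfl | h0
  · refine summable_of_ne_finset_zero (s := {0}) fun n hn => ?_
    have : 2 * n + k ≠ 0 := by simp at hn; omega
    rw [zero_pow this, mul_zero]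
  have hs : Summable fun n : ℕ => C * ((n : ℝ) + 1) ^ m * r ^ n := by
    have := (summable_nat_add_iff 1).2
      (summable_pow_mul_geometric_of_norm_lt_one (R := ℝ) m (r := r)
        (by rwa [Real.norm_of_nonneg h0.le]))
    refine (this.mul_left (C / r)).congr fun n => ?_
    push_cast
    field_simp
    ring
  refine Summable.of_norm_bounded hs fun n => ?_
  rw [norm_mul, norm_pow, Real.norm_of_nonneg h0.le]
  have : r ^ (2 * n + k) ≤ r ^ n := pow_le_pow_of_le_one h0.le h1.le (by omega)
  exact mul_le_mul (hc n) this (by positivity) ((abs_nonneg _).trans (hc n))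

theorem polyBound_mul {c d : ℕ → ℝ} {C D : ℝ} {m l : ℕ}
    (hc : ∀ n, |c n| ≤ C * ((n : ℝ) + 1) ^ m) (hd : ∀ n, |d n| ≤ D * ((n : ℝ) + 1) ^ l) (n : ℕ) :
    |c n * d n| ≤ (C * D) * ((n : ℝ) + 1) ^ (m + l) := by
  rw [abs_mul]
  calc _ ≤ (C * ((n : ℝ) + 1) ^ m) * (D * ((n : ℝ) + 1) ^ l) :=
        mul_le_mul (hc n) (hd n) (abs_nonneg _) ((abs_nonneg _).trans (hc n))
    _ = _ := by ring

theorem polyBound_linear (a b : ℝ) (n : ℕ) :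
    |a * n + b| ≤ (|a| + |b|) * ((n : ℝ) + 1) ^ 1 := by
  have hn : (0 : ℝ) ≤ n := n.cast_nonneg
  calc |a * n + b| ≤ |a * n| + |b| := abs_add_le _ _
    _ = |a| * n + |b| := by rw [abs_mul, abs_of_nonneg hn]
    _ ≤ _ := by nlinarith [abs_nonneg a, abs_nonneg b]

theorem hasDerivAt_tsum_mul_pow {c : ℕ → ℝ} {C : ℝ} {m : ℕ}
    (hc : ∀ n, |c n| ≤ C * ((n : ℝ) + 1) ^ m) (k : ℕ) {r : ℝ} (hr : r ∈ Ioo (0 : ℝ) 1) :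
    HasDerivAt (fun x : ℝ => ∑' n, c n * x ^ (2 * n + k))
      ((∑' n, (2 * n + k) * c n * r ^ (2 * n + k)) / r) r := by
  obtain ⟨h0, h1⟩ := hr
  set ρ := (r + 1) / 2 with hρ
  have hd := polyBound_mul (polyBound_linear 2 k) hc
  have hs := (summable_mul_pow_of_polyBound hd k (r := ρ) (by positivity) (by linarith)).norm
  -- Staying above `r / 2` bounds the factor `1 / x` by `2 / r`; staying below `ρ < 1` gives a
  -- summable majorant.
  have key := hasDerivAt_tsum_of_isPreconnected (t := Ioo (r / 2) ρ) (y₀ := r) (y := r)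
    (g := fun n (x : ℝ) => c n * x ^ (2 * n + k))
    (g' := fun n (x : ℝ) => ((2 * n + k) * c n * x ^ (2 * n + k)) / x)
    (hs.mul_left (2 / r)) isOpen_Ioo isPreconnected_Ioo ?_ ?_ ⟨by linarith, by linarith⟩
    (summable_mul_pow_of_polyBound hc k h0.le h1) ⟨by linarith, by linarith⟩
  · rwa [tsum_div_const] at key
  · intro n x hx
    have hx0 : 0 < x := by linarith [hx.1]
    refine ((hasDerivAt_pow (2 * n + k) x).const_mul (c n)).congr_deriv ?_
    rcases Nat.eq_zero_or_pos (2 * n + k) with h | h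
    · have : (2 * (n : ℝ) + k) = 0 := by exact_mod_cast h
      rw [this, h]; simp
    · have hp : x ^ (2 * n + k) = x ^ (2 * n + k - 1) * x := by
        rw [← pow_succ, Nat.sub_add_cancel h]
      rw [hp]
      push_cast
      field_simp
  · intro n x hx
    have hx0 : 0 < x := by linarith [hx.1]
    rw [norm_div, norm_mul, norm_mul _ (ρ ^ _), norm_pow, norm_pow, Real.norm_of_nonneg hx0.le,
      Real.norm_of_nonneg (by positivity : 0 ≤ ρ), div_eq_mul_inv, mul_comm]
    refine mul_le_mul ?_ ?_ (by positivity) (by positivity)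
    · rw [← one_div, div_le_div_iff₀ hx0 h0]; linarith [hx.1]
    · exact mul_le_mul_of_nonneg_left (pow_le_pow_left₀ hx0.le hx.2.le _) (norm_nonneg _)

/-- Letting `r → 1` in finite partial sums turns a bound on the function into one on `∑ d n`,
because the tail is nonnegative. But `d n ≥ ε / n` eventually, and the harmonic series diverges. -/
theorem not_bddAbove_tsum_mul_pow {d : ℕ → ℝ} {C : ℝ} {m : ℕ}
    (hd : ∀ n, |d n| ≤ C * ((n : ℝ) + 1) ^ m) (k N : ℕ) {ε : ℝ} (hε : 0 < ε)
    (hN : ∀ n, N ≤ n → ε ≤ n * d n) (B : ℝ)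
    (hB : ∀ r ∈ Ioo (1 / 2 : ℝ) 1, ∑' n, d n * r ^ (2 * n + k) ≤ B) : False := by
  have hpos : ∀ n, N ≤ n → 0 ≤ d n := fun n hn => by
    by_contra! h
    have : (n : ℝ) * d n ≤ 0 := mul_nonpos_of_nonneg_of_nonpos n.cast_nonneg h.le
    linarith [hN n hn]
  have hpart : ∀ M, N ≤ M → ∑ n ∈ Finset.range M, d n ≤ B := by
    intro M hM
    have hcont : Tendsto (fun r : ℝ => ∑ n ∈ Finset.range M, d n * r ^ (2 * n + k)) (𝓝[<] 1)
        (𝓝 (∑ n ∈ Finset.range M, d n)) := by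
      have : Continuous fun r : ℝ => ∑ n ∈ Finset.range M, d n * r ^ (2 * n + k) := by fun_prop
      simpa using (this.tendsto 1).mono_left nhdsWithin_le_nhds
    refine le_of_tendsto hcont ?_
    filter_upwards [Ioo_mem_nhdsLT (by norm_num : (1 / 2 : ℝ) < 1)] with r hr
    refine le_trans ?_ (hB r hr)
    have h0 : 0 ≤ r := by linarith [hr.1]
    refine Summable.sum_le_tsum _ (fun n hn => ?_) (summable_mul_pow_of_polyBound hd k h0 hr.2)
    exact mul_nonneg (hpos n (by simp at hn; omega)) (by positivity)
  have hsum : Summable fun n => d (n + N) := by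
    refine summable_of_sum_range_le (c := B - ∑ n ∈ Finset.range N, d n)
      (fun n => hpos _ (by omega)) fun M => ?_
    have h := hpart (N + M) (by omega)
    rw [Finset.sum_range_add] at h
    simp only [add_comm _ N]
    linarith
  have h2 : Summable fun n : ℕ => ε * (1 / ((n + N : ℕ) : ℝ)) := by
    refine Summable.of_nonneg_of_le (fun n => by positivity) (fun n => ?_) hsum
    have h := hN (n + N) (by omega)
    have hp := hpos (n + N) (by omega)
    rcases Nat.eq_zero_or_pos (n + N) with h0 | h0
    · rw [h0] at h; simp at h; linarith
    · have : (0 : ℝ) < ((n + N : ℕ) : ℝ) := by exact_mod_cast h0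
      rw [mul_one_div, div_le_iff₀ this]; linarith
  have h3 := (summable_mul_left_iff hε.ne').1 h2
  exact Real.not_summable_one_div_natCast
    ((summable_nat_add_iff (f := fun n : ℕ => 1 / (n : ℝ)) N).1 h3)

/-! ### The hypergeometric coefficients of the homogeneous `(α,β)`-harmonic functions -/

/-- The Taylor coefficients of `₂F₁(-α, k - β; k + 1; ·)`. -/
def hgCoeff (α β : ℝ) (k : ℕ) : ℕ → ℝ
  | 0 => 1
  | n + 1 => hgCoeff α β k n * (((n - α) * (n + k - β)) / ((n + k + 1) * (n + 1)))

section hgCoeff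

variable {α β : ℝ} (k : ℕ)

theorem hgCoeff_succ (n : ℕ) :
    (((n : ℝ) + k + 1) * (n + 1)) * hgCoeff α β k (n + 1)
      = ((n - α) * (n + k - β)) * hgCoeff α β k n := by
  rw [hgCoeff]; field_simp

theorem hgCoeff_ne_zero (hα : ∀ n : ℤ, α ≠ n) (hβ : ∀ n : ℤ, β ≠ n) (n : ℕ) :
    hgCoeff α β k n ≠ 0 := by
  induction n with
  | zero => simp [hgCoeff]
  | succ n ih =>
    have h1 : (n : ℝ) - α ≠ 0 := fun h => hα n (by push_cast; linarith)
    have h2 : (n : ℝ) + k - β ≠ 0 := fun h => hβ (n + k) (by push_cast; linarith)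
    have h3 : (n : ℝ) + k + 1 ≠ 0 := by positivity
    have h4 : (n : ℝ) + 1 ≠ 0 := by positivity
    rw [hgCoeff]
    exact mul_ne_zero ih (div_ne_zero (mul_ne_zero h1 h2) (mul_ne_zero h3 h4))

/-- The ratio of consecutive coefficients is eventually in `[0, 1]`: its denominator exceeds its
numerator by `(2 + α + β) n + k + 1 + α (k - β)`. -/
theorem exists_hgCoeff_bound (hlo : -1 < α + β) : ∃ C : ℝ, ∀ n, |hgCoeff α β k n| ≤ C := by
  obtain ⟨N, hN⟩ := exists_nat_ge (|α| + |β| + |α * (k - β)|)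
  refine ⟨∑ i ∈ Finset.range (N + 1), |hgCoeff α β k i|, fun n => ?_⟩
  have hsmall : ∀ n ≤ N, |hgCoeff α β k n| ≤ ∑ i ∈ Finset.range (N + 1), |hgCoeff α β k i| :=
    fun n hn => Finset.single_le_sum (f := fun i => |hgCoeff α β k i|)
      (fun _ _ => abs_nonneg _) (by simp; omega)
  rcases le_total n N with h | h
  · exact hsmall n h
  induction n, h using Nat.le_induction with
  | base => exact hsmall N le_rfl
  | succ n hn ih =>
    refine le_trans ?_ ih
    have hn' : (N : ℝ) ≤ n := by exact_mod_cast hn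
    have hk : (0 : ℝ) ≤ k := k.cast_nonneg
    have := le_abs_self α
    have := le_abs_self β
    have := neg_le_abs (α * (k - β))
    have := abs_nonneg α
    have := abs_nonneg β
    have := abs_nonneg (α * (k - β))
    have hn0 : (0 : ℝ) ≤ n := n.cast_nonneg
    rw [hgCoeff, abs_mul]
    refine mul_le_of_le_one_right (abs_nonneg _) ?_
    rw [abs_of_nonneg (div_nonneg (mul_nonneg (by linarith) (by linarith)) (by positivity)),
      div_le_one (by positivity)]
    nlinarith [mul_nonneg hn0 (by linarith : 0 ≤ 1 + α + β)]

/-- The sequence `n² |a_n|` is eventually nondecreasing and the sign of `a_n` eventually constant.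
So `σ` is the sign of `a_N`, and `ε` is the value at `N`. -/
theorem exists_hgCoeff_lower_bound (hα : ∀ n : ℤ, α ≠ n) (hβ : ∀ n : ℤ, β ≠ n)
    (hhi : α + β < 0) : ∃ (σ ε : ℝ) (N : ℕ), |σ| = 1 ∧ 0 < ε ∧
      ∀ n : ℕ, N ≤ n → ε ≤ n ^ 2 * (σ * hgCoeff α β k n) := by
  obtain ⟨N, hN⟩ := exists_nat_ge (|α| + |β| + 1 +
    (|k - α - β - α * (k - β)| + |α * (k - β)|) / (-(α + β)))
  set E := |k - α - β - α * (k - β)| + |α * (k - β)| with hE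
  have hE0 : 0 ≤ E := by positivity
  have hEd : 0 ≤ E / (-(α + β)) := div_nonneg hE0 (by linarith)
  have hN1 : (1 : ℝ) ≤ N := by linarith [abs_nonneg α, abs_nonneg β]
  obtain ⟨σ, hσ, hσa⟩ : ∃ σ : ℝ, |σ| = 1 ∧ 0 < σ * hgCoeff α β k N := by
    rcases lt_or_gt_of_ne (hgCoeff_ne_zero k hα hβ N) with h | h
    · exact ⟨-1, by simp, by linarith⟩
    · exact ⟨1, by simp, by linarith⟩
  refine ⟨σ, N ^ 2 * (σ * hgCoeff α β k N), N, hσ, by positivity, fun n hn => ?_⟩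
  induction n, hn using Nat.le_induction with
  | base => exact le_rfl
  | succ n hn ih =>
    refine ih.trans ?_
    have hn' : (N : ℝ) ≤ n := by exact_mod_cast hn
    have hk : (0 : ℝ) ≤ k := k.cast_nonneg
    have hn1 : (1 : ℝ) ≤ n := hN1.trans hn'
    have hpos : 0 < (n : ℝ) ^ 2 * (σ * hgCoeff α β k n) := lt_of_lt_of_le (by positivity) ih
    have ha : 0 < σ * hgCoeff α β k n := pos_of_mul_pos_right hpos (by positivity)
    have hEn : E ≤ n * (-(α + β)) := by
      rw [← div_le_iff₀ (by linarith)]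
      linarith [abs_nonneg α, abs_nonneg β]
    -- The right side minus the left is `-(α+β) n²` plus a linear remainder bounded below by `-E n`;
    -- the choice of `N` makes the quadratic term win.
    have hpoly : (n : ℝ) ^ 2 * (n + k + 1) ≤ (n + 1) * ((n - α) * (n + k - β)) := by
      have h1 : -(|k - α - β - α * (k - β)| * n) ≤ (k - α - β - α * (k - β)) * n := by
        nlinarith [neg_abs_le (k - α - β - α * (k - β))]
      have h2 : -(|α * (k - β)| * n) ≤ -(α * (k - β)) := by
        nlinarith [le_abs_self (α * (k - β)), abs_nonneg (α * (k - β))]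
      have h3 : E * n ≤ n * (-(α + β)) * n := by nlinarith
      rw [hE] at h3
      nlinarith
    rw [hgCoeff]
    push_cast
    have : ((n : ℝ) + 1) ^ 2 * (σ * (hgCoeff α β k n *
        ((n - α) * (n + k - β) / ((n + k + 1) * (n + 1)))))
        = (σ * hgCoeff α β k n) * ((n + 1) * ((n - α) * (n + k - β)) / (n + k + 1)) := by
      field_simp
    rw [this, mul_comm]
    refine mul_le_mul_of_nonneg_left ?_ ha.le
    rw [le_div_iff₀ (by positivity)]
    exact hpoly

/-- The radial part `r ^ k * ₂F₁(-α, k - β; k + 1; r²)` of the homogeneous `(α,β)`-harmonic function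
of degree `k`. -/
def hgRadial (α β : ℝ) (k : ℕ) (r : ℝ) : ℝ := ∑' n, hgCoeff α β k n * r ^ (2 * n + k)

/-- The radial part of `z̄ ∂_z̄` of the homogeneous `(α,β)`-harmonic function of degree `k`. -/
def hgRadialBar (α β : ℝ) (k : ℕ) (r : ℝ) : ℝ := ∑' n : ℕ, n * hgCoeff α β k n * r ^ (2 * n + k)

theorem exists_polyBound_linear_mul_hgCoeff (hlo : -1 < α + β) (a b : ℝ) :
    ∃ C : ℝ, ∀ n : ℕ, |(a * n + b) * hgCoeff α β k n| ≤ C * ((n : ℝ) + 1) ^ 1 := by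
  obtain ⟨C, hC⟩ := exists_hgCoeff_bound k hlo
  have h : ∀ n, |hgCoeff α β k n| ≤ C * ((n : ℝ) + 1) ^ 0 := by simpa using hC
  exact ⟨_, polyBound_mul (polyBound_linear a b) h⟩

theorem summable_linear_mul_hgCoeff (hlo : -1 < α + β) (a b : ℝ) {r : ℝ}
    (hr : r ∈ Ico (0 : ℝ) 1) :
    Summable fun n : ℕ => (a * n + b) * hgCoeff α β k n * r ^ (2 * n + k) := by
  obtain ⟨C, hC⟩ := exists_polyBound_linear_mul_hgCoeff k hlo a b
  exact summable_mul_pow_of_polyBound hC k hr.1 hr.2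

theorem hasDerivAt_hgRadial (hlo : -1 < α + β) {r : ℝ} (hr : r ∈ Ioo (0 : ℝ) 1) :
    HasDerivAt (hgRadial α β k) ((k * hgRadial α β k r + 2 * hgRadialBar α β k r) / r) r := by
  obtain ⟨C, hC⟩ := exists_hgCoeff_bound k hlo
  have h : ∀ n, |hgCoeff α β k n| ≤ C * ((n : ℝ) + 1) ^ 0 := by simpa using hC
  refine (hasDerivAt_tsum_mul_pow h k hr).congr_deriv ?_
  rw [div_left_inj' hr.1.ne']
  have hr' : r ∈ Ico (0 : ℝ) 1 := ⟨hr.1.le, hr.2⟩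
  have h0 := summable_linear_mul_hgCoeff k hlo 0 1 hr'
  have h1 := summable_linear_mul_hgCoeff k hlo 1 0 hr'
  simp only [zero_mul, zero_add, one_mul, add_zero] at h0 h1
  rw [hgRadial, hgRadialBar, ← tsum_mul_left, ← tsum_mul_left,
    ← (h0.mul_left _).tsum_add (h1.mul_left _)]
  exact tsum_congr fun n => by ring

/-- The coefficient recurrence, summed, shows that `T = ∑ (n+k) n a_n r^(2n+k)` satisfies a linear
equation with factor `1 - r²`; solving for `T` closes the system. -/
theorem hasDerivAt_hgRadialBar (hlo : -1 < α + β) {r : ℝ} (hr : r ∈ Ioo (0 : ℝ) 1) :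
    HasDerivAt (hgRadialBar α β k)
      ((-k * hgRadialBar α β k r - 2 * r ^ 2 / (1 - r ^ 2) *
        ((α + β) * hgRadialBar α β k r + α * (k - β) * hgRadial α β k r)) / r) r := by
  obtain ⟨C, hC⟩ := exists_polyBound_linear_mul_hgCoeff k hlo 1 0
  simp only [one_mul, add_zero] at hC
  refine (hasDerivAt_tsum_mul_pow hC k hr).congr_deriv ?_
  rw [div_left_inj' hr.1.ne']
  have hr' : r ∈ Ico (0 : ℝ) 1 := ⟨hr.1.le, hr.2⟩
  have h0 := summable_linear_mul_hgCoeff k hlo 0 1 hr'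
  have h1 := summable_linear_mul_hgCoeff k hlo 1 0 hr'
  simp only [zero_mul, zero_add, one_mul, add_zero] at h0 h1
  have h2 : Summable fun n : ℕ => (n + k : ℝ) * (n * hgCoeff α β k n) * r ^ (2 * n + k) := by
    have := polyBound_mul (polyBound_linear 1 k) hC
    simp only [one_mul] at this
    exact summable_mul_pow_of_polyBound this k hr'.1 hr'.2
  have hne : 1 - r ^ 2 ≠ 0 := by nlinarith [hr.1, hr.2]
  have hA : ∑' n : ℕ, (2 * n + k : ℝ) * (n * hgCoeff α β k n) * r ^ (2 * n + k)
      = 2 * (∑' n : ℕ, (n + k : ℝ) * (n * hgCoeff α β k n) * r ^ (2 * n + k))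
        - k * hgRadialBar α β k r := by
    rw [hgRadialBar, ← tsum_mul_left, ← tsum_mul_left,
      ← (h2.mul_left _).tsum_sub (h1.mul_left _)]
    exact tsum_congr fun n => by ring
  -- The term `n = 0` vanishes, so shifting the index costs nothing but the factor `r²`.
  have hB : ∑' n : ℕ, (n + k : ℝ) * (n * hgCoeff α β k n) * r ^ (2 * n + k)
      = r ^ 2 * ((∑' n : ℕ, (n + k : ℝ) * (n * hgCoeff α β k n) * r ^ (2 * n + k))
        - ((α + β) * hgRadialBar α β k r + α * (k - β) * hgRadial α β k r)) := by
    rw [hgRadial, hgRadialBar, ← tsum_mul_left, ← tsum_mul_left,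
      ← (h1.mul_left _).tsum_add (h0.mul_left _),
      ← h2.tsum_sub ((h1.mul_left _).add (h0.mul_left _)), ← tsum_mul_left, h2.tsum_eq_zero_add]
    simp only [Nat.cast_zero, zero_mul, mul_zero, zero_add]
    refine tsum_congr fun n => ?_
    have := hgCoeff_succ (α := α) (β := β) k n
    push_cast
    rw [show 2 * (n + 1) + k = 2 * n + k + 2 by ring, pow_add]
    linear_combination (r ^ (2 * n + k) * r ^ 2) * this
  rw [hA]
  set T := ∑' n : ℕ, (n + k : ℝ) * (n * hgCoeff α β k n) * r ^ (2 * n + k)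
  field_simp
  linear_combination 2 * hB

/-- Neither `z̄ ∂_z̄` nor `z ∂_z` of a homogeneous `(α,β)`-harmonic function is bounded. -/
theorem hgRadialBar_add_mul_not_bounded (hα : ∀ n : ℤ, α ≠ n) (hβ : ∀ n : ℤ, β ≠ n)
    (hlo : -1 < α + β) (hhi : α + β < 0) {b : ℝ} (hb : 0 ≤ b) (B : ℝ)
    (hB : ∀ r ∈ Ioo (1 / 2 : ℝ) 1, |hgRadialBar α β k r + b * hgRadial α β k r| ≤ B) : False := by
  obtain ⟨σ, ε, N, hσ, hε, hN⟩ := exists_hgCoeff_lower_bound k hα hβ hhi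
  obtain ⟨C, hC⟩ := exists_polyBound_linear_mul_hgCoeff k hlo 1 b
  have hd : ∀ n : ℕ, |σ * ((1 * n + b) * hgCoeff α β k n)| ≤ C * ((n : ℝ) + 1) ^ 1 := fun n => by
    rw [abs_mul, hσ, one_mul]; exact hC n
  refine not_bddAbove_tsum_mul_pow hd k N hε (fun n hn => ?_) B fun r hr => ?_
  · have h := hN n hn
    have hn0 : (0 : ℝ) ≤ n := n.cast_nonneg
    have ha : 0 ≤ σ * hgCoeff α β k n := by
      by_contra! h'
      nlinarith [mul_nonneg (sq_nonneg (n : ℝ)) (neg_nonneg.2 h'.le)]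
    nlinarith [mul_nonneg (mul_nonneg hn0 hb) ha]
  · have hr' : r ∈ Ico (0 : ℝ) 1 := ⟨by linarith [hr.1], hr.2⟩
    have h0 := summable_linear_mul_hgCoeff (α := α) (β := β) k hlo 0 1 hr'
    have h1 := summable_linear_mul_hgCoeff (α := α) (β := β) k hlo 1 0 hr'
    simp only [zero_mul, zero_add, one_mul, add_zero] at h0 h1
    have : ∑' n : ℕ, σ * ((1 * n + b) * hgCoeff α β k n) * r ^ (2 * n + k)
        = σ * (hgRadialBar α β k r + b * hgRadial α β k r) := by
      rw [hgRadial, hgRadialBar, ← tsum_mul_left (a := b), ← h1.tsum_add (h0.mul_left _),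
        ← tsum_mul_left]
      exact tsum_congr fun n => by ring
    rw [this]
    refine (le_abs_self _).trans ?_
    rw [abs_mul, hσ, one_mul]
    exact hB r hr

end hgCoeff

/-! ### The first order system satisfied by the Fourier modes -/

/-- `L` may blow up at the ends of the interval, so uniqueness is applied on a compact subinterval
around `t₀` and `t`, where the norm of `L` is a Lipschitz constant. -/
theorem eqOn_zero_of_linear_ode {E : Type*} [NormedAddCommGroup E] [NormedSpace ℝ E] {a b : ℝ}
    {L : ℝ → E →L[ℝ] E} (hL : ContinuousOn L (Ioo a b)) {f : ℝ → E}
    (hf : ∀ t ∈ Ioo a b, HasDerivAt f (L t (f t)) t) {t₀ : ℝ} (ht₀ : t₀ ∈ Ioo a b)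
    (h0 : f t₀ = 0) {t : ℝ} (ht : t ∈ Ioo a b) : f t = 0 := by
  obtain ⟨a', ha', ha''⟩ := exists_between (lt_min ht₀.1 ht.1)
  obtain ⟨b', hb', hb''⟩ := exists_between (max_lt ht₀.2 ht.2)
  have hsub : Icc a' b' ⊆ Ioo a b := fun x hx => ⟨ha'.trans_le hx.1, hx.2.trans_lt hb''⟩
  obtain ⟨M, hM⟩ := isCompact_Icc.exists_bound_of_continuousOn (hL.mono hsub)
  have hlt := lt_min_iff.1 ha''
  have hgt := max_lt_iff.1 hb'
  refine ODE_solution_unique_of_mem_Ioo (v := fun t x => L t x) (K := M.toNNReal)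
    (s := fun _ => univ) (a := a') (b := b') (f := f) (g := fun _ => 0) ?_ ⟨hlt.1, hgt.1⟩
    (fun s hs => ⟨hf s (hsub ⟨hs.1.le, hs.2.le⟩), mem_univ _⟩)
    (fun s hs => ⟨by simpa using hasDerivAt_const s (0 : E), mem_univ _⟩) h0 ⟨hlt.2, hgt.2⟩
  intro s hs
  refine ((L s).lipschitz.weaken ?_).lipschitzOnWith
  rw [← NNReal.coe_le_coe]
  exact (hM s ⟨hs.1.le, hs.2.le⟩).trans (Real.le_coe_toNNReal M)

theorem eq_zero_of_linear_system {A B C D : ℝ → ℝ} {a b : ℝ} (hA : ContinuousOn A (Ioo a b))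
    (hB : ContinuousOn B (Ioo a b)) (hC : ContinuousOn C (Ioo a b)) (hD : ContinuousOn D (Ioo a b))
    {y q : ℝ → ℂ} (hy : ∀ t ∈ Ioo a b, HasDerivAt y (A t * y t + B t * q t) t)
    (hq : ∀ t ∈ Ioo a b, HasDerivAt q (C t * y t + D t * q t) t)
    {t₀ : ℝ} (ht₀ : t₀ ∈ Ioo a b) (hy0 : y t₀ = 0) (hq0 : q t₀ = 0) {t : ℝ} (ht : t ∈ Ioo a b) :
    y t = 0 ∧ q t = 0 := by
  let fst := ContinuousLinearMap.fst ℝ ℂ ℂ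
  let snd := ContinuousLinearMap.snd ℝ ℂ ℂ
  let L : ℝ → (ℂ × ℂ) →L[ℝ] (ℂ × ℂ) := fun t =>
    A t • fst.prod 0 + B t • snd.prod 0 + (C t • (0 : ℂ × ℂ →L[ℝ] ℂ).prod fst
      + D t • (0 : ℂ × ℂ →L[ℝ] ℂ).prod snd)
  have hL : ContinuousOn L (Ioo a b) :=
    ((hA.smul continuousOn_const).add (hB.smul continuousOn_const)).add
      ((hC.smul continuousOn_const).add (hD.smul continuousOn_const))
  have := eqOn_zero_of_linear_ode hL (f := fun t => (y t, q t))
    (fun s hs => ((hy s hs).prodMk (hq s hs)).congr_deriv (by simp [L, fst, snd])) ht₀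
    (by simp [hy0, hq0]) ht
  simpa using this

section ModeSystem

variable {α β : ℝ} {k : ℕ}

/-- Used for the limit of the Wronskian at `0`. The factor `r` in the second bound comes from the
weight `n`, which kills the term `n = 0`. -/
theorem exists_hgRadial_bound (hlo : -1 < α + β) :
    ∃ M : ℝ, 0 ≤ M ∧ ∀ r ∈ Ioo (0 : ℝ) (1 / 2),
      |hgRadial α β k r| ≤ M ∧ |hgRadialBar α β k r| ≤ M * r := by
  have hr' : (1 / 2 : ℝ) ∈ Ico (0 : ℝ) 1 := by constructor <;> norm_num
  have h0 := (summable_linear_mul_hgCoeff (α := α) (β := β) k hlo 0 1 hr').norm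
  have h1 := (summable_linear_mul_hgCoeff (α := α) (β := β) k hlo 1 0 hr').norm
  simp only [zero_mul, zero_add, one_mul, add_zero] at h0 h1
  set M₀ := ∑' n, ‖hgCoeff α β k n * (1 / 2 : ℝ) ^ (2 * n + k)‖
  set M₁ := ∑' n : ℕ, ‖n * hgCoeff α β k n * (1 / 2 : ℝ) ^ (2 * n + k)‖
  have hM₀ : 0 ≤ M₀ := tsum_nonneg fun _ => norm_nonneg _
  have hM₁ : 0 ≤ M₁ := tsum_nonneg fun _ => norm_nonneg _
  refine ⟨M₀ + 2 * M₁, by positivity, fun r hr => ⟨?_, ?_⟩⟩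
  · have : ‖hgRadial α β k r‖ ≤ M₀ := tsum_of_norm_bounded h0.hasSum fun n => by
      rw [norm_mul, norm_mul, norm_pow, norm_pow, Real.norm_of_nonneg hr.1.le,
        Real.norm_of_nonneg hr'.1]
      exact mul_le_mul_of_nonneg_left (pow_le_pow_left₀ hr.1.le hr.2.le _) (norm_nonneg _)
    rw [Real.norm_eq_abs] at this
    linarith
  · have : ‖hgRadialBar α β k r‖ ≤ 2 * r * M₁ :=
      tsum_of_norm_bounded (h1.hasSum.mul_left (2 * r)) fun n => by
        rcases n.eq_zero_or_pos with rfl | hn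
        · simp
        rw [norm_mul, norm_mul _ ((1 / 2 : ℝ) ^ _), norm_pow, norm_pow,
          Real.norm_of_nonneg hr.1.le, Real.norm_of_nonneg hr'.1, mul_left_comm]
        refine mul_le_mul_of_nonneg_left ?_ (norm_nonneg _)
        have h2 : (2 * r) ^ (2 * n + k) ≤ 2 * r :=
          pow_le_of_le_one (by linarith [hr.1]) (by linarith [hr.2]) (by omega)
        calc r ^ (2 * n + k) = (2 * r) ^ (2 * n + k) * (1 / 2) ^ (2 * n + k) := by
              rw [← mul_pow]; ring_nf
          _ ≤ _ := mul_le_mul_of_nonneg_right h2 (by positivity)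
    rw [Real.norm_eq_abs] at this
    nlinarith [mul_nonneg hM₀ hr.1.le]

/-- If `hgRadial` vanished identically, its derivative would force `hgRadialBar` to vanish too,
against unboundedness with `b = 0`. -/
theorem exists_hgRadial_ne_zero (hα : ∀ n : ℤ, α ≠ n) (hβ : ∀ n : ℤ, β ≠ n)
    (hlo : -1 < α + β) (hhi : α + β < 0) : ∃ r ∈ Ioo (0 : ℝ) 1, hgRadial α β k r ≠ 0 := by
  by_contra! h
  refine hgRadialBar_add_mul_not_bounded k hα hβ hlo hhi le_rfl 0 fun r hr => ?_
  have hr' : r ∈ Ioo (0 : ℝ) 1 := ⟨by linarith [hr.1], hr.2⟩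
  have h1 : HasDerivAt (hgRadial α β k) 0 r := by
    refine (hasDerivAt_const r (0 : ℝ)).congr_of_eventuallyEq ?_
    filter_upwards [Ioo_mem_nhds hr'.1 hr'.2] with x hx using h x hx
  have h2 := (hasDerivAt_hgRadial (α := α) (β := β) k hlo hr').unique h1
  rw [h r hr', div_eq_zero_iff] at h2
  have h3 : hgRadialBar α β k r = 0 := by
    rcases h2 with h2 | h2
    · linarith
    · exact absurd h2 hr'.1.ne'
  simp [h3]

variable {y q : ℝ → ℂ}

theorem wronskian_eq_zero (hlo : -1 < α + β) (hhi : α + β < 0)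
    (hy : ∀ r ∈ Ioo (0 : ℝ) 1, HasDerivAt y ((k * y r + 2 * q r) / r) r)
    (hq : ∀ r ∈ Ioo (0 : ℝ) 1, HasDerivAt q ((-k * q r - 2 * r ^ 2 / (1 - r ^ 2) *
      ((α + β) * q r + α * (k - β) * y r)) / r) r)
    {M : ℝ} (hM : ∀ r ∈ Ioo (0 : ℝ) (1 / 2), ‖y r‖ ≤ M ∧ ‖q r‖ ≤ M * r)
    {r : ℝ} (hr : r ∈ Ioo (0 : ℝ) 1) :
    y r * hgRadialBar α β k r = q r * hgRadial α β k r := by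
  -- The trace of the system is `-2 (α+β) r / (1 - r²)`; the last factor compensates it, so `W` is
  -- constant. It is at most `1` since `α + β < 0`.
  set W : ℝ → ℂ := fun x => (y x * hgRadialBar α β k x - q x * hgRadial α β k x) *
    (((1 - x ^ 2) ^ (-(α + β)) : ℝ) : ℂ) with hW
  have hderiv : ∀ x ∈ Ioo (0 : ℝ) 1, HasDerivAt W 0 x := by
    intro x hx
    have hpos : 0 < 1 - x ^ 2 := by nlinarith [hx.1, hx.2]
    have h1 : HasDerivAt (fun x : ℝ => 1 - x ^ 2) (-(2 * x)) x := by
      simpa using (hasDerivAt_pow 2 x).const_sub 1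
    have h2 := (h1.rpow_const (p := -(α + β)) (Or.inl hpos.ne')).ofReal_comp
    have h3 := (((hy x hx).mul (hasDerivAt_hgRadialBar (α := α) (β := β) k hlo hx).ofReal_comp).sub
      ((hq x hx).mul (hasDerivAt_hgRadial (α := α) (β := β) k hlo hx).ofReal_comp)).mul h2
    refine h3.congr_deriv ?_
    have hx0 : (x : ℂ) ≠ 0 := by exact_mod_cast hx.1.ne'
    have hx1 : (1 - x ^ 2 : ℂ) ≠ 0 := by exact_mod_cast hpos.ne'
    rw [Real.rpow_sub_one hpos.ne']
    push_cast
    simp only [Pi.mul_apply, Pi.sub_apply]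
    field_simp
    ring
  have hconst : ∀ x ∈ Ioo (0 : ℝ) 1, W x = W r := fun x hx =>
    isOpen_Ioo.is_const_of_deriv_eq_zero isPreconnected_Ioo
      (fun z hz => (hderiv z hz).differentiableAt.differentiableWithinAt)
      (fun z hz => (hderiv z hz).deriv) hx hr
  obtain ⟨C, hC0, hC⟩ := exists_hgRadial_bound (α := α) (β := β) (k := k) hlo
  have hlim : Tendsto W (𝓝[>] 0) (𝓝 0) := by
    have hb : Tendsto (fun x : ℝ => 2 * M * C * x) (𝓝[>] 0) (𝓝 0) := by
      have : Continuous fun x : ℝ => 2 * M * C * x := by fun_prop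
      simpa using (this.tendsto 0).mono_left nhdsWithin_le_nhds
    refine squeeze_zero_norm' ?_ hb
    filter_upwards [Ioo_mem_nhdsGT (by norm_num : (0 : ℝ) < 1 / 2)] with x hx
    have hpos : 0 ≤ 1 - x ^ 2 := by nlinarith [hx.1, hx.2]
    have hle : (1 - x ^ 2) ^ (-(α + β)) ≤ 1 :=
      Real.rpow_le_one hpos (by nlinarith [hx.1]) (by linarith)
    have hnn := Real.rpow_nonneg hpos (-(α + β))
    obtain ⟨hM1, hM2⟩ := hM x hx
    obtain ⟨hC1, hC2⟩ := hC x hx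
    have hM0 : 0 ≤ M := (norm_nonneg _).trans hM1
    rw [hW]
    simp only
    rw [norm_mul, Complex.norm_real, Real.norm_of_nonneg hnn]
    refine (mul_le_of_le_one_right (norm_nonneg _) hle).trans ?_
    refine (norm_sub_le _ _).trans ?_
    rw [norm_mul, norm_mul, Complex.norm_real, Complex.norm_real, Real.norm_eq_abs,
      Real.norm_eq_abs]
    have h1 := mul_le_mul hM1 hC2 (abs_nonneg _) hM0
    have h2 := mul_le_mul hM2 hC1 (abs_nonneg _) (mul_nonneg hM0 hx.1.le)
    linarith
  have hWr : W r = 0 := by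
    refine tendsto_nhds_unique (Tendsto.congr' ?_ tendsto_const_nhds) hlim
    filter_upwards [Ioo_mem_nhdsGT (zero_lt_one' ℝ)] with x hx using (hconst x hx).symm
  have hpos : 0 < 1 - r ^ 2 := by nlinarith [hr.1, hr.2]
  rcases mul_eq_zero.1 hWr with h | h
  · exact sub_eq_zero.1 h
  · exact absurd (Complex.ofReal_eq_zero.1 h) (Real.rpow_pos_of_pos hpos _).ne'

/-- A solution of the mode system that is regular at `0` and for which some combination
`q + b y` is bounded near `1` vanishes. -/
theorem eq_zero_of_mode_system (hα : ∀ n : ℤ, α ≠ n) (hβ : ∀ n : ℤ, β ≠ n)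
    (hlo : -1 < α + β) (hhi : α + β < 0)
    (hy : ∀ r ∈ Ioo (0 : ℝ) 1, HasDerivAt y ((k * y r + 2 * q r) / r) r)
    (hq : ∀ r ∈ Ioo (0 : ℝ) 1, HasDerivAt q ((-k * q r - 2 * r ^ 2 / (1 - r ^ 2) *
      ((α + β) * q r + α * (k - β) * y r)) / r) r)
    {M : ℝ} (hM : ∀ r ∈ Ioo (0 : ℝ) (1 / 2), ‖y r‖ ≤ M ∧ ‖q r‖ ≤ M * r)
    {b B : ℝ} (hb : 0 ≤ b) (hB : ∀ r ∈ Ioo (1 / 2 : ℝ) 1, ‖q r + b * y r‖ ≤ B)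
    {r : ℝ} (hr : r ∈ Ioo (0 : ℝ) 1) : y r = 0 := by
  obtain ⟨r₀, hr₀, hne⟩ := exists_hgRadial_ne_zero (k := k) hα hβ hlo hhi
  have hneC : (hgRadial α β k r₀ : ℂ) ≠ 0 := by exact_mod_cast hne
  -- With this `c` the difference of `y` and its multiple vanishes at `r₀`; the Wronskian identity
  -- makes the `q` component vanish there as well.
  set c : ℂ := y r₀ / hgRadial α β k r₀ with hc
  have hW := wronskian_eq_zero hlo hhi hy hq hM hr₀
  have hsol : ∀ x ∈ Ioo (0 : ℝ) 1,
      y x - c * hgRadial α β k x = 0 ∧ q x - c * hgRadialBar α β k x = 0 := by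
    intro x hx
    have hid : ContinuousOn (fun t : ℝ => t) (Ioo 0 1) := continuousOn_id
    have h0 : ∀ t ∈ Ioo (0 : ℝ) 1, t ≠ 0 := fun t ht => ht.1.ne'
    have h1 : ∀ t ∈ Ioo (0 : ℝ) 1, 1 - t ^ 2 ≠ 0 := fun t ht => by nlinarith [ht.1, ht.2]
    have hw : ContinuousOn (fun t : ℝ => 2 * t ^ 2 / (1 - t ^ 2)) (Ioo 0 1) :=
      ContinuousOn.div (by fun_prop) (by fun_prop) h1
    refine eq_zero_of_linear_system (a := 0) (b := 1) (A := fun t => k / t) (B := fun t => 2 / t)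
      (C := fun t => -(2 * t ^ 2 / (1 - t ^ 2)) * (α * (k - β)) / t)
      (D := fun t => (-k - 2 * t ^ 2 / (1 - t ^ 2) * (α + β)) / t)
      (y := fun x => y x - c * hgRadial α β k x) (q := fun x => q x - c * hgRadialBar α β k x)
      (continuousOn_const.div hid h0) (continuousOn_const.div hid h0)
      ((hw.neg.mul continuousOn_const).div hid h0)
      ((continuousOn_const.sub (hw.mul continuousOn_const)).div hid h0)
      (fun t ht => ?_) (fun t ht => ?_) hr₀ ?_ ?_ hx
    · refine ((hy t ht).sub ((hasDerivAt_hgRadial (α := α) (β := β) k hlo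
        ht).ofReal_comp.const_mul c)).congr_deriv ?_
      push_cast
      ring
    · refine ((hq t ht).sub ((hasDerivAt_hgRadialBar (α := α) (β := β) k hlo
        ht).ofReal_comp.const_mul c)).congr_deriv ?_
      push_cast
      ring
    · rw [hc]; field_simp; simp
    · rw [hc, div_mul_eq_mul_div, hW]; field_simp; simp
  have hc0 : c = 0 := by
    by_contra hc0
    have hcpos : 0 < ‖c‖ := norm_pos_iff.2 hc0
    refine hgRadialBar_add_mul_not_bounded k hα hβ hlo hhi hb (B / ‖c‖) fun x hx => ?_
    obtain ⟨h1, h2⟩ := hsol x ⟨by linarith [hx.1], hx.2⟩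
    have h3 := hB x hx
    rw [sub_eq_zero.1 h1, sub_eq_zero.1 h2] at h3
    rw [le_div_iff₀ hcpos, mul_comm]
    have h4 : c * hgRadialBar α β k x + b * (c * hgRadial α β k x)
        = c * ((hgRadialBar α β k x + b * hgRadial α β k x : ℝ) : ℂ) := by push_cast; ring
    rwa [h4, norm_mul, Complex.norm_real, Real.norm_eq_abs] at h3
  simpa [hc0] using (hsol r hr).1

end ModeSystem

/-! ### Fourier modes on circles -/

/-- `∫₀^{2π} f(r e^{iθ}) e^{-ikθ} dθ`. -/
def fourierMode (k : ℤ) (f : ℂ → ℂ) (r : ℝ) : ℂ :=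
  ∫ θ in (0 : ℝ)..2 * Real.pi, f (circleMap 0 r θ) * Complex.exp (-(k * θ * Complex.I))

theorem isOpen_unitDisc : IsOpen unitDisc := isOpen_ball

theorem circleMap_mem_unitDisc {r : ℝ} (hr : r ∈ Ico (0 : ℝ) 1) (θ : ℝ) :
    circleMap 0 r θ ∈ unitDisc := by
  simp [unitDisc, abs_of_nonneg hr.1, hr.2]

theorem norm_exp_neg_mul_I (k : ℤ) (θ : ℝ) : ‖Complex.exp (-(k * θ * Complex.I))‖ = 1 := by
  have : -(k * θ * Complex.I) = ((-(k * θ) : ℝ) : ℂ) * Complex.I := by push_cast; ring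
  rw [this, Complex.norm_exp_ofReal_mul_I]

theorem continuous_fourierMode_integrand {f : ℂ → ℂ} (hf : ContinuousOn f unitDisc) (k : ℤ) {r : ℝ}
    (hr : r ∈ Ico (0 : ℝ) 1) :
    Continuous fun θ : ℝ => f (circleMap 0 r θ) * Complex.exp (-(k * θ * Complex.I)) :=
  (hf.comp_continuous (continuous_circleMap 0 r) (circleMap_mem_unitDisc hr)).mul (by fun_prop)

theorem fourierMode_congr {f g : ℂ → ℂ} (k : ℤ) {r : ℝ}
    (h : ∀ θ : ℝ, f (circleMap 0 r θ) = g (circleMap 0 r θ)) :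
    fourierMode k f r = fourierMode k g r := by
  simp only [fourierMode, h]

theorem fourierMode_add {f g : ℂ → ℂ} (hf : ContinuousOn f unitDisc) (hg : ContinuousOn g unitDisc)
    (k : ℤ) {r : ℝ} (hr : r ∈ Ico (0 : ℝ) 1) :
    fourierMode k (fun z => f z + g z) r = fourierMode k f r + fourierMode k g r := by
  simp only [fourierMode, add_mul]
  exact intervalIntegral.integral_add
    ((continuous_fourierMode_integrand hf k hr).intervalIntegrable _ _)
    ((continuous_fourierMode_integrand hg k hr).intervalIntegrable _ _)

theorem fourierMode_const_mul (f : ℂ → ℂ) (k : ℤ) (r : ℝ) (c : ℂ) :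
    fourierMode k (fun z => c * f z) r = c * fourierMode k f r := by
  simp only [fourierMode, mul_assoc]
  exact intervalIntegral.integral_const_mul _ _

theorem norm_fourierMode_le {f : ℂ → ℂ} (k : ℤ) {r M : ℝ}
    (h : ∀ θ : ℝ, ‖f (circleMap 0 r θ)‖ ≤ M) : ‖fourierMode k f r‖ ≤ 2 * Real.pi * M := by
  have := intervalIntegral.norm_integral_le_of_norm_le_const (a := 0) (b := 2 * Real.pi)
    (f := fun θ : ℝ => f (circleMap 0 r θ) * Complex.exp (-(k * θ * Complex.I))) (C := M)
    fun θ _ => by rw [norm_mul, norm_exp_neg_mul_I, mul_one]; exact h θ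
  rw [sub_zero, abs_of_pos Real.two_pi_pos] at this
  rw [mul_comm (2 * Real.pi)]
  exact this

/-! ### Wirtinger derivatives in polar coordinates -/

theorem fderiv_apply_eq_re_im (f : ℂ → ℂ) (z w : ℂ) :
    fderiv ℝ f z w = w.re * fderiv ℝ f z 1 + w.im * fderiv ℝ f z Complex.I := by
  have : w = w.re • (1 : ℂ) + w.im • Complex.I := by
    rw [Complex.real_smul, Complex.real_smul, mul_one, Complex.re_add_im]
  conv_lhs => rw [this]
  rw [map_add, map_smul, map_smul, Complex.real_smul, Complex.real_smul]

theorem fderiv_apply_eq_dz_dzbar (f : ℂ → ℂ) (z w : ℂ) :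
    fderiv ℝ f z w = w * dz f z + (starRingEnd ℂ) w * dzbar f z := by
  have hw := Complex.re_add_im w
  have hw' : (starRingEnd ℂ) w = w.re - w.im * Complex.I := by
    apply Complex.ext <;> simp
  rw [fderiv_apply_eq_re_im f z w, dz, dzbar, hw']
  linear_combination (1 / 2 * (fderiv ℝ f z 1 - Complex.I * fderiv ℝ f z Complex.I)) * hw
    + ((w.im : ℂ) * fderiv ℝ f z Complex.I) * Complex.I_mul_I

theorem continuousOn_fderiv_apply {f : ℂ → ℂ} (hf : ContDiffOn ℝ 1 f unitDisc) (w : ℂ) :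
    ContinuousOn (fun z => fderiv ℝ f z w) unitDisc :=
  (hf.continuousOn_fderiv_of_isOpen isOpen_unitDisc le_rfl).clm_apply continuousOn_const

theorem continuousOn_dz {f : ℂ → ℂ} (hf : ContDiffOn ℝ 1 f unitDisc) :
    ContinuousOn (dz f) unitDisc :=
  continuousOn_const.mul ((continuousOn_fderiv_apply hf 1).sub
    (continuousOn_const.mul (continuousOn_fderiv_apply hf _)))

theorem continuousOn_dzbar {f : ℂ → ℂ} (hf : ContDiffOn ℝ 1 f unitDisc) :
    ContinuousOn (dzbar f) unitDisc :=
  continuousOn_const.mul ((continuousOn_fderiv_apply hf 1).add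
    (continuousOn_const.mul (continuousOn_fderiv_apply hf _)))

theorem contDiffOn_dzbar {f : ℂ → ℂ} (hf : ContDiffOn ℝ 2 f unitDisc) :
    ContDiffOn ℝ 1 (dzbar f) unitDisc := by
  have h := hf.fderiv_of_isOpen (m := 1) isOpen_unitDisc (by norm_num)
  exact contDiffOn_const.mul ((h.clm_apply contDiffOn_const).add
    (contDiffOn_const.mul (h.clm_apply contDiffOn_const)))

/-- The operator `z ∂_z`. -/
def eulerDz (f : ℂ → ℂ) (z : ℂ) : ℂ := z * dz f z

/-- The operator `z̄ ∂_z̄`. -/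
def eulerDzbar (f : ℂ → ℂ) (z : ℂ) : ℂ := (starRingEnd ℂ) z * dzbar f z

theorem continuousOn_eulerDz {f : ℂ → ℂ} (hf : ContDiffOn ℝ 1 f unitDisc) :
    ContinuousOn (eulerDz f) unitDisc := continuousOn_id.mul (continuousOn_dz hf)

theorem continuousOn_eulerDzbar {f : ℂ → ℂ} (hf : ContDiffOn ℝ 1 f unitDisc) :
    ContinuousOn (eulerDzbar f) unitDisc :=
  Complex.continuous_conj.continuousOn.mul (continuousOn_dzbar hf)

theorem contDiffOn_eulerDzbar {f : ℂ → ℂ} (hf : ContDiffOn ℝ 2 f unitDisc) :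
    ContDiffOn ℝ 1 (eulerDzbar f) unitDisc :=
  (Complex.conjCLE.contDiff.contDiffOn (s := unitDisc)).mul (contDiffOn_dzbar hf)

theorem dz_conj_mul {g : ℂ → ℂ} {z : ℂ} (hg : DifferentiableAt ℝ g z) :
    dz (fun w => (starRingEnd ℂ) w * g w) z = (starRingEnd ℂ) z * dz g z := by
  have hc : HasFDerivAt (fun w : ℂ => (starRingEnd ℂ) w) (Complex.conjCLE : ℂ →L[ℝ] ℂ) z :=
    Complex.conjCLE.hasFDerivAt
  have h := (hc.mul hg.hasFDerivAt).fderiv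
  have h' : fderiv ℝ (fun w => (starRingEnd ℂ) w * g w) z = _ := h
  simp only [dz, h']
  simp
  linear_combination ((1 / 2 : ℂ) * g z) * Complex.I_mul_I

/-- This is `r ∂_r = z ∂_z + z̄ ∂_z̄` under the integral sign, dominated by the maximum of the
derivative on a closed disc of radius `ρ < 1`. -/
theorem hasDerivAt_fourierMode {f : ℂ → ℂ} (hf : ContDiffOn ℝ 1 f unitDisc) (k : ℤ) {r : ℝ}
    (hr : r ∈ Ioo (0 : ℝ) 1) :
    HasDerivAt (fourierMode k f)
      ((fourierMode k (eulerDz f) r + fourierMode k (eulerDzbar f) r) / r) r := by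
  obtain ⟨h0, h1⟩ := hr
  obtain ⟨ρ, hrρ, hρ1⟩ := exists_between h1
  have hsub : closedBall (0 : ℂ) ρ ⊆ unitDisc := closedBall_subset_ball hρ1
  have hcont := hf.continuousOn_fderiv_of_isOpen isOpen_unitDisc le_rfl
  obtain ⟨M, hM⟩ := (isCompact_closedBall (0 : ℂ) ρ).exists_bound_of_continuousOn (hcont.mono hsub)
  have hIco : ∀ x ∈ Ioo 0 ρ, x ∈ Ico (0 : ℝ) 1 := fun x hx => ⟨hx.1.le, hx.2.trans hρ1⟩
  have hrρ' : r ∈ Ioo 0 ρ := ⟨h0, hrρ⟩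
  have key := intervalIntegral.hasDerivAt_integral_of_dominated_loc_of_deriv_le
    (μ := volume) (a := 0) (b := 2 * Real.pi) (s := Ioo 0 ρ) (x₀ := r) (bound := fun _ => M)
    (F := fun x θ => f (circleMap 0 x θ) * Complex.exp (-(k * θ * Complex.I)))
    (F' := fun x θ => fderiv ℝ f (circleMap 0 x θ) (circleMap 0 1 θ) *
      Complex.exp (-(k * θ * Complex.I)))
    (Ioo_mem_nhds h0 hrρ) ?_
    ((continuous_fourierMode_integrand hf.continuousOn k (hIco r hrρ')).intervalIntegrable _ _)
    ?_ ?_ (by simp) ?_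
  · refine key.2.congr_deriv ?_
    have hE := continuousOn_eulerDz hf
    have hE' := continuousOn_eulerDzbar hf
    rw [← fourierMode_add hE hE' k (hIco r hrρ'), fourierMode, ← intervalIntegral.integral_div]
    refine intervalIntegral.integral_congr fun θ _ => ?_
    have hz : circleMap 0 r θ = r * circleMap 0 1 θ := by simp [circleMap]
    have hr0 : (r : ℂ) ≠ 0 := by exact_mod_cast h0.ne'
    simp only [eulerDz, eulerDzbar]
    rw [fderiv_apply_eq_dz_dzbar, hz, map_mul, Complex.conj_ofReal]
    field_simp
  · filter_upwards [Ioo_mem_nhds h0 hrρ] with x hx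
    exact (continuous_fourierMode_integrand hf.continuousOn k (hIco x hx)).aestronglyMeasurable
  · refine Continuous.aestronglyMeasurable ?_
    exact ((hcont.comp_continuous (continuous_circleMap 0 r)
      (circleMap_mem_unitDisc (hIco r hrρ'))).clm_apply (continuous_circleMap 0 1)).mul
      (by fun_prop)
  · refine Eventually.of_forall fun θ _ x hx => ?_
    rw [norm_mul, norm_exp_neg_mul_I, mul_one]
    refine (ContinuousLinearMap.le_opNorm _ _).trans ?_
    rw [norm_circleMap_zero, abs_one, mul_one]
    exact hM _ (by simp [abs_of_pos hx.1, hx.2.le])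
  · refine Eventually.of_forall fun θ _ x hx => ?_
    have hd : HasDerivAt (fun x : ℝ => circleMap 0 x θ) (circleMap 0 1 θ) x := by
      simpa [circleMap] using (Complex.ofRealCLM.hasDerivAt (x := x)).mul_const
        (Complex.exp (θ * Complex.I))
    have hfd := ((hf.differentiableOn one_ne_zero).differentiableAt
      (isOpen_unitDisc.mem_nhds (circleMap_mem_unitDisc (hIco x hx) θ))).hasFDerivAt
    exact (hfd.comp_hasDerivAt x hd).mul_const _

/-- Integration by parts in `θ`, with `-i ∂_θ = z ∂_z - z̄ ∂_z̄`: the `θ`-derivative of the periodic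
integrand is `g` times the character, so that mode of `g` is zero. -/
theorem mul_fourierMode {f : ℂ → ℂ} (hf : ContDiffOn ℝ 1 f unitDisc) (k : ℤ) {r : ℝ}
    (hr : r ∈ Ico (0 : ℝ) 1) :
    k * fourierMode k f r = fourierMode k (eulerDz f) r - fourierMode k (eulerDzbar f) r := by
  have hE := continuousOn_eulerDz hf
  have hE' := continuousOn_eulerDzbar hf
  set g : ℂ → ℂ := fun z => Complex.I * (eulerDz f z + (-1) * eulerDzbar f z)
    + (-(k * Complex.I)) * f z with hg
  have hE'' : ContinuousOn (fun z => (-1) * eulerDzbar f z) unitDisc := continuousOn_const.mul hE'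
  have hg1 : ContinuousOn (fun z => Complex.I * (eulerDz f z + (-1) * eulerDzbar f z)) unitDisc :=
    continuousOn_const.mul (hE.add hE'')
  have hg2 : ContinuousOn (fun z => (-(k * Complex.I)) * f z) unitDisc :=
    continuousOn_const.mul hf.continuousOn
  have hderiv : ∀ θ : ℝ, HasDerivAt
      (fun θ : ℝ => f (circleMap 0 r θ) * Complex.exp (-(k * θ * Complex.I)))
      (g (circleMap 0 r θ) * Complex.exp (-(k * θ * Complex.I))) θ := by
    intro θ
    have hfd := ((hf.differentiableOn one_ne_zero).differentiableAt
      (isOpen_unitDisc.mem_nhds (circleMap_mem_unitDisc hr θ))).hasFDerivAt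
    have h1 := hfd.comp_hasDerivAt θ (hasDerivAt_circleMap 0 r θ)
    have h2 : HasDerivAt (fun θ : ℝ => -(k * θ * Complex.I)) (-(k * Complex.I)) θ := by
      simpa using (((Complex.ofRealCLM.hasDerivAt (x := θ)).const_mul (k : ℂ)).mul_const
        Complex.I).fun_neg
    refine (h1.mul h2.cexp).congr_deriv ?_
    rw [fderiv_apply_eq_dz_dzbar, map_mul, Complex.conj_I, hg]
    simp only [eulerDz, eulerDzbar, Function.comp]
    ring
  have hint : fourierMode k g r = 0 := by
    rw [fourierMode, intervalIntegral.integral_eq_sub_of_hasDerivAt (fun θ _ => hderiv θ)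
      ((continuous_fourierMode_integrand (hg1.add hg2) k hr).intervalIntegrable _ _)]
    have h1 : circleMap 0 r (2 * Real.pi) = circleMap 0 r 0 := by
      simpa using periodic_circleMap 0 r 0
    have h2 : Complex.exp (-(k * ((2 * Real.pi : ℝ) : ℂ) * Complex.I)) = 1 := by
      rw [Complex.exp_eq_one_iff]
      exact ⟨-k, by push_cast; ring⟩
    rw [h1, h2]
    simp
  rw [hg, fourierMode_add hg1 hg2 k hr, fourierMode_const_mul, fourierMode_const_mul,
    fourierMode_add hE hE'' k hr, fourierMode_const_mul] at hint
  refine mul_left_cancel₀ Complex.I_ne_zero ?_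
  linear_combination -hint

/-- A continuous function on the disc all of whose Fourier modes vanish is zero. -/
theorem eq_zero_of_fourierMode_eq_zero {f : ℂ → ℂ} (hf : ContinuousOn f unitDisc)
    (h : ∀ k : ℤ, ∀ r ∈ Ioo (0 : ℝ) 1, fourierMode k f r = 0) : ∀ z ∈ unitDisc, f z = 0 := by
  have hne : ∀ z ∈ unitDisc, z ≠ 0 → f z = 0 := by
    intro z hz hz0
    have hr : ‖z‖ ∈ Ioo (0 : ℝ) 1 := ⟨norm_pos_iff.2 hz0, by simpa [unitDisc] using hz⟩
    have : Fact (0 < 2 * Real.pi) := ⟨Real.two_pi_pos⟩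
    have hper : Function.Periodic (fun θ : ℝ => f (circleMap 0 ‖z‖ θ)) (2 * Real.pi) :=
      (periodic_circleMap 0 ‖z‖).comp f
    have hcont : Continuous fun θ : ℝ => f (circleMap 0 ‖z‖ θ) :=
      hf.comp_continuous (continuous_circleMap 0 _) (circleMap_mem_unitDisc ⟨hr.1.le, hr.2⟩)
    have hcl : Continuous hper.lift :=
      (QuotientAddGroup.isQuotientMap_mk (G := ℝ)
        (N := AddSubgroup.zmultiples (2 * Real.pi))).continuous_iff.2 hcont
    let F : C(AddCircle (2 * Real.pi), ℂ) := ⟨hper.lift, hcl⟩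
    have hcoeff : fourierCoeff F = 0 := by
      funext n
      rw [fourierCoeff_eq_intervalIntegral F n 0, zero_add]
      have hn := h n ‖z‖ hr
      rw [fourierMode] at hn
      rw [Pi.zero_apply, smul_eq_zero]
      right
      rw [← hn]
      refine intervalIntegral.integral_congr fun θ _ => ?_
      have hFθ : F (θ : AddCircle (2 * Real.pi)) = f (circleMap 0 ‖z‖ θ) := rfl
      rw [hFθ, fourier_coe_apply, smul_eq_mul, mul_comm]
      congr 2
      have : (Real.pi : ℂ) ≠ 0 := by exact_mod_cast Real.pi_ne_zero
      push_cast
      field_simp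
    -- Vanishing coefficients are summable, so the Fourier series converges pointwise to `F`.
    have hs := has_pointwise_sum_fourier_series_of_summable (f := F)
      (by rw [hcoeff]; exact summable_zero) (z.arg : AddCircle (2 * Real.pi))
    rw [hcoeff] at hs
    have h0 : F (z.arg : AddCircle (2 * Real.pi)) = 0 := hs.unique (by simp)
    have hF : F (z.arg : AddCircle (2 * Real.pi)) = f (circleMap 0 ‖z‖ z.arg) := rfl
    rwa [hF, circleMap, zero_add, Complex.norm_mul_exp_arg_mul_I] at h0
  intro z hz
  by_cases hz0 : z = 0
  · subst hz0
    have hc := (hf.continuousAt (isOpen_unitDisc.mem_nhds hz)).tendsto.mono_left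
      (nhdsWithin_le_nhds (s := {0}ᶜ))
    refine tendsto_nhds_unique hc (Tendsto.congr' ?_ tendsto_const_nhds)
    filter_upwards [self_mem_nhdsWithin, nhdsWithin_le_nhds (isOpen_unitDisc.mem_nhds hz)]
      with w hw hw' using (hne w hw' hw).symm
  · exact hne z hz hz0

/-! ### The modes of an `(α,β)`-harmonic function -/

/-- The integral of a function in `H¹_G` times `z` (or `z̄`) against a character is bounded. -/
theorem exists_fourierMode_bound {v : ℂ → ℂ} (hv : MemHardyG 1 v) {e : ℂ → ℂ}
    (he : ∀ z ∈ unitDisc, ‖e z‖ ≤ 1) (k : ℤ) :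
    ∃ B : ℝ, ∀ r ∈ Ioo (0 : ℝ) 1, ‖fourierMode k (fun z => e z * v z) r‖ ≤ B := by
  have hfin := hv.hardyNorm_lt_top
  have hne : ENNReal.ofReal (2 * Real.pi) * hardyNorm 1 v ≠ ∞ :=
    ENNReal.mul_ne_top ENNReal.ofReal_ne_top hfin.ne
  refine ⟨(ENNReal.ofReal (2 * Real.pi) * hardyNorm 1 v).toReal, fun r hr => ?_⟩
  rw [← toReal_enorm]
  refine ENNReal.toReal_mono hne ?_
  have h1 : integralMean 1 r v ≤ hardyNorm 1 v := by
    rw [hardyNorm, if_neg ENNReal.one_ne_top, ENNReal.toReal_one]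
    exact le_iSup₂ (f := fun r (_ : r ∈ Ioo (0 : ℝ) 1) => integralMean 1 r v) r hr
  refine le_trans ?_ (mul_le_mul_right h1 _)
  rw [integralMean, div_one, ENNReal.rpow_one, ← mul_assoc,
    ← ENNReal.ofReal_mul Real.two_pi_pos.le, mul_one_div_cancel Real.two_pi_pos.ne',
    ENNReal.ofReal_one, one_mul, fourierMode, intervalIntegral.integral_of_le Real.two_pi_pos.le]
  refine (enorm_integral_le_lintegral_enorm _).trans (lintegral_mono fun θ => ?_)
  rw [ENNReal.rpow_one, enorm_mul, enorm_mul]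
  have h2 : ‖Complex.exp (-(k * θ * Complex.I))‖ₑ = 1 := by
    rw [← ofReal_norm, norm_exp_neg_mul_I, ENNReal.ofReal_one]
  have h3 : ‖e (circleMap 0 r θ)‖ₑ ≤ 1 := by
    rw [← ofReal_norm, ← ENNReal.ofReal_one]
    exact ENNReal.ofReal_le_ofReal (he _ (circleMap_mem_unitDisc ⟨hr.1.le, hr.2⟩ θ))
  rw [h2, mul_one]
  exact mul_le_of_le_one_left' h3

section Harmonic

variable {α β : ℝ} {u : ℂ → ℂ}

/-- The equation multiplied by `|z|² / (1 - |z|²)`. Its coefficients are then radial, so it passes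
to each Fourier mode. -/
theorem eulerDz_eulerDzbar_of_isABHarmonic (hu : IsABHarmonic α β u) {z : ℂ} (hz : z ∈ unitDisc) :
    eulerDz (eulerDzbar u) z = -((‖z‖ : ℂ) ^ 2 / (1 - (‖z‖ : ℂ) ^ 2)) *
      (α * eulerDz u z + (β * eulerDzbar u z + (-(α * β)) * u z)) := by
  have hz1 : ‖z‖ < 1 := by simpa [unitDisc] using hz
  have hne : (1 - (‖z‖ : ℂ) ^ 2) ≠ 0 := by
    have : (1 - ‖z‖ ^ 2 : ℝ) ≠ 0 := by nlinarith [norm_nonneg z]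
    exact_mod_cast this
  have hpde := (mul_eq_zero.1 (hu.laplaceAB_eq_zero z hz)).resolve_left hne
  have hd : DifferentiableAt ℝ (dzbar u) z :=
    ((contDiffOn_dzbar hu.contDiffOn).differentiableOn one_ne_zero).differentiableAt
      (isOpen_unitDisc.mem_nhds hz)
  have h1 : eulerDz (eulerDzbar u) z = z * (starRingEnd ℂ z * dz (dzbar u) z) := by
    rw [eulerDz, show eulerDzbar u = fun w => (starRingEnd ℂ) w * dzbar u w from rfl,
      dz_conj_mul hd]
  have h2 : z * starRingEnd ℂ z = (‖z‖ : ℂ) ^ 2 := Complex.mul_conj' z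
  rw [h1, ← mul_assoc, h2, eulerDz, eulerDzbar]
  field_simp
  linear_combination (‖z‖ : ℂ) ^ 2 * hpde

theorem hasDerivAt_fourierMode_eulerDzbar (hu : IsABHarmonic α β u) (k : ℤ) {r : ℝ}
    (hr : r ∈ Ioo (0 : ℝ) 1) :
    HasDerivAt (fourierMode k (eulerDzbar u))
      ((-k * fourierMode k (eulerDzbar u) r - 2 * r ^ 2 / (1 - r ^ 2) *
        (α * (fourierMode k (eulerDzbar u) r + k * fourierMode k u r)
          + β * fourierMode k (eulerDzbar u) r - α * β * fourierMode k u r)) / r) r := by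
  have hr' : r ∈ Ico (0 : ℝ) 1 := ⟨hr.1.le, hr.2⟩
  have hu1 : ContDiffOn ℝ 1 u unitDisc := hu.contDiffOn.of_le one_le_two
  have hQ := contDiffOn_eulerDzbar hu.contDiffOn
  refine (hasDerivAt_fourierMode hQ k hr).congr_deriv ?_
  have hA := mul_fourierMode hQ k hr'
  have hy := mul_fourierMode hu1 k hr'
  have hE := continuousOn_eulerDz hu1
  have hE' := continuousOn_eulerDzbar hu1
  have h1 : ContinuousOn (fun z => (α : ℂ) * eulerDz u z) unitDisc := continuousOn_const.mul hE
  have h2 : ContinuousOn (fun z => (β : ℂ) * eulerDzbar u z) unitDisc := continuousOn_const.mul hE'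
  have h3 : ContinuousOn (fun z => (-(α * β) : ℂ) * u z) unitDisc :=
    continuousOn_const.mul hu1.continuousOn
  have h23 : ContinuousOn (fun z => (β : ℂ) * eulerDzbar u z + (-(α * β) : ℂ) * u z) unitDisc :=
    h2.add h3
  have hmode : fourierMode k (eulerDz (eulerDzbar u)) r = -((r : ℂ) ^ 2 / (1 - (r : ℂ) ^ 2)) *
      (α * fourierMode k (eulerDz u) r + (β * fourierMode k (eulerDzbar u) r
        + (-(α * β)) * fourierMode k u r)) := by
    rw [← fourierMode_const_mul u, ← fourierMode_const_mul (eulerDzbar u),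
      ← fourierMode_const_mul (eulerDz u), ← fourierMode_add h2 h3 k hr',
      ← fourierMode_add h1 h23 k hr', ← fourierMode_const_mul]
    refine fourierMode_congr k fun θ => ?_
    rw [eulerDz_eulerDzbar_of_isABHarmonic hu (circleMap_mem_unitDisc hr' θ), norm_circleMap_zero,
      abs_of_pos hr.1]
  have hz : fourierMode k (eulerDz u) r = fourierMode k (eulerDzbar u) r + k * fourierMode k u r :=
    by linear_combination -hy
  rw [hz] at hmode
  congr 1
  -- `hA` trades the mode of `(z̄ ∂_z̄)² u` for that of `z ∂_z (z̄ ∂_z̄ u)` minus `k q`, hence the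
  -- factor `2`.
  linear_combination 2 * hmode + hA

theorem exists_fourierMode_bound_zero (hu : ContDiffOn ℝ 1 u unitDisc) (k : ℤ) :
    ∃ M : ℝ, ∀ r ∈ Ioo (0 : ℝ) (1 / 2), ‖fourierMode k u r‖ ≤ M ∧
      ‖fourierMode k (eulerDz u) r‖ ≤ M * r ∧ ‖fourierMode k (eulerDzbar u) r‖ ≤ M * r := by
  have hsub : closedBall (0 : ℂ) (1 / 2) ⊆ unitDisc := closedBall_subset_ball (by norm_num)
  have hK := isCompact_closedBall (0 : ℂ) (1 / 2)
  obtain ⟨M₀, h0⟩ := hK.exists_bound_of_continuousOn (hu.continuousOn.mono hsub)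
  obtain ⟨M₁, h1⟩ := hK.exists_bound_of_continuousOn ((continuousOn_dz hu).mono hsub)
  obtain ⟨M₂, h2⟩ := hK.exists_bound_of_continuousOn ((continuousOn_dzbar hu).mono hsub)
  set M := max M₀ (max M₁ M₂)
  refine ⟨2 * Real.pi * M, fun r hr => ?_⟩
  have hmem : ∀ θ : ℝ, circleMap 0 r θ ∈ closedBall (0 : ℂ) (1 / 2) := fun θ => by
    simpa [abs_of_pos hr.1] using hr.2.le
  refine ⟨norm_fourierMode_le k fun θ => (h0 _ (hmem θ)).trans (le_max_left _ _), ?_, ?_⟩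
  · rw [mul_assoc]
    refine norm_fourierMode_le k fun θ => ?_
    rw [eulerDz, norm_mul, norm_circleMap_zero, abs_of_pos hr.1, mul_comm]
    exact mul_le_mul_of_nonneg_right ((h1 _ (hmem θ)).trans
      ((le_max_left _ _).trans (le_max_right _ _))) hr.1.le
  · rw [mul_assoc]
    refine norm_fourierMode_le k fun θ => ?_
    rw [eulerDzbar, norm_mul, Complex.norm_conj, norm_circleMap_zero, abs_of_pos hr.1, mul_comm]
    exact mul_le_mul_of_nonneg_right ((h2 _ (hmem θ)).trans
      ((le_max_right _ _).trans (le_max_right _ _))) hr.1.le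

theorem fourierMode_eq_zero_of_isABHarmonic (hα : ∀ n : ℤ, α ≠ n) (hβ : ∀ n : ℤ, β ≠ n)
    (hlo : -1 < α + β) (hhi : α + β < 0) (hu : IsABHarmonic α β u)
    (hd : MemHardyG 1 (dz u) ∨ MemHardyG 1 (dzbar u)) (k : ℤ) {r : ℝ} (hr : r ∈ Ioo (0 : ℝ) 1) :
    fourierMode k u r = 0 := by
  have hu1 : ContDiffOn ℝ 1 u unitDisc := hu.contDiffOn.of_le one_le_two
  obtain ⟨M, hM⟩ := exists_fourierMode_bound_zero hu1 k
  have hIco : ∀ x ∈ Ioo (0 : ℝ) 1, x ∈ Ico (0 : ℝ) 1 := fun x hx => ⟨hx.1.le, hx.2⟩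
  have hz : ∀ x ∈ Ioo (0 : ℝ) 1, fourierMode k (eulerDz u) x
      = fourierMode k (eulerDzbar u) x + k * fourierMode k u x := fun x hx => by
    linear_combination -mul_fourierMode hu1 k (hIco x hx)
  have hy := fun x (hx : x ∈ Ioo (0 : ℝ) 1) => hasDerivAt_fourierMode hu1 k hx
  have hq := fun x (hx : x ∈ Ioo (0 : ℝ) 1) => hasDerivAt_fourierMode_eulerDzbar hu k hx
  have hhalf : ∀ x ∈ Ioo (1 / 2 : ℝ) 1, x ∈ Ioo (0 : ℝ) 1 := fun x hx =>
    ⟨by linarith [hx.1], hx.2⟩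
  have hhalf' : ∀ x ∈ Ioo (0 : ℝ) (1 / 2), x ∈ Ioo (0 : ℝ) 1 := fun x hx =>
    ⟨hx.1, by linarith [hx.2]⟩
  have hB : (∃ B : ℝ, ∀ x ∈ Ioo (0 : ℝ) 1, ‖fourierMode k (eulerDz u) x‖ ≤ B) ∨
      ∃ B : ℝ, ∀ x ∈ Ioo (0 : ℝ) 1, ‖fourierMode k (eulerDzbar u) x‖ ≤ B := by
    refine hd.imp (fun h => exists_fourierMode_bound h (e := fun z => z) (fun z hz => ?_) k)
      (fun h => exists_fourierMode_bound h (e := fun z => starRingEnd ℂ z) (fun z hz => ?_) k)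
    · exact (by simpa [unitDisc] using hz : ‖z‖ < 1).le
    · rw [Complex.norm_conj]
      exact (by simpa [unitDisc] using hz : ‖z‖ < 1).le
  obtain ⟨m, rfl | rfl⟩ := k.eq_nat_or_neg
  · have main := fun b B hb hB => eq_zero_of_mode_system (k := m) (y := fourierMode m u)
      (q := fourierMode m (eulerDzbar u)) (M := M) (b := b) (B := B) hα hβ hlo hhi
      (fun x hx => (hy x hx).congr_deriv ?_) (fun x hx => (hq x hx).congr_deriv ?_)
      (fun x hx => ⟨(hM x hx).1, (hM x hx).2.2⟩) hb hB hr
    · rcases hB with ⟨B, hB⟩ | ⟨B, hB⟩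
      · refine main m B m.cast_nonneg fun x hx => ?_
        have := hB x (hhalf x hx)
        rw [hz x (hhalf x hx)] at this
        simpa using this
      · refine main 0 B le_rfl fun x hx => ?_
        simpa using hB x (hhalf x hx)
    · rw [hz x hx]; push_cast; ring
    · push_cast; ring
  · set p : ℝ → ℂ := fun x => fourierMode (-m) (eulerDzbar u) x - m * fourierMode (-m) u x with hp
    have hzp : ∀ x ∈ Ioo (0 : ℝ) 1, fourierMode (-m) (eulerDz u) x = p x := fun x hx => by
      rw [hz x hx, hp]; push_cast; ring
    have main := fun b B hb hB => eq_zero_of_mode_system (α := β) (β := α) (k := m)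
      (y := fourierMode (-m) u) (q := p) (M := M) (b := b) (B := B) hβ hα
      (by linarith) (by linarith) (fun x hx => (hy x hx).congr_deriv ?_)
      (fun x hx => ((hq x hx).sub ((hy x hx).const_mul (m : ℂ))).congr_deriv ?_)
      (fun x hx => ⟨(hM x hx).1, by rw [← hzp x (hhalf' x hx)]; exact (hM x hx).2.1⟩) hb hB hr
    · rcases hB with ⟨B, hB⟩ | ⟨B, hB⟩
      · refine main 0 B le_rfl fun x hx => ?_
        have := hB x (hhalf x hx)
        rw [hzp x (hhalf x hx)] at this
        simpa using this
      · refine main m B m.cast_nonneg fun x hx => ?_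
        simpa [hp] using hB x (hhalf x hx)
    · rw [hzp x hx, hp]; push_cast; ring
    · rw [hzp x hx, hp]; push_cast; ring

end Harmonic

end

theorem theorem2p3 (α β : ℝ) (hα : ∀ n : ℤ, α ≠ (n : ℝ)) (hβ : ∀ n : ℤ, β ≠ (n : ℝ))
    (hlo : -1 < α + β) (hhi : α + β < 0)
    (u : ℂ → ℂ) (hu : IsABHarmonic α β u)
    (hd : MemHardyG 1 (dz u) ∨ MemHardyG 1 (dzbar u)) :
    ∀ z ∈ unitDisc, u z = 0 :=
  eq_zero_of_fourierMode_eq_zero hu.contDiffOn.continuousOn fun k _ hr =>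
    fourierMode_eq_zero_of_isABHarmonic hα hβ hlo hhi hu hd k hr
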